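/- Let $n\ge 2$, let $e_n$ be the $n$-th standard unit vector of $\mathbb{R}^n$, and let $B_r(y)$ denote the open ball of radius $r$ centred at $y$. There exists a constant $\tau_n>0$ depending only on $n$ with the following property. Let $\Omega\subset\mathbb{R}^n$ be a bounded domain (open and connected) with $0\in\partial\Omega$, let $D:=\sup_{x\in\Omega}|x|$, and suppose that for some $\rho>0$ the ball $B_\rho(-\rho e_n)$ is an exterior ball at $0$, that is, $B_\rho(-\rho e_n)\subset\mathbb{R}^n\setminus\overline{\Omega}$. If $\rho\ge D/\tau_n$, then $$\int_\Omega |\nabla u|^2\,dx\;\ge\;\frac{n^2}{4}\int_\Omega\frac{u^2}{|x|^2}\,dx\qquad\text{for all } u\in C_c^\infty(\Omega).$$ If in addition $\Omega$ satisfies an interior ball condition at $0$, that is, there are $y\in\mathbb{R}^n$ and $r>0$ with $|y|=r$ and $B_r(y)\subset\Omega$, then the constant $n^2/4$ is sharp: it is the largest real number $c$ such that $\int_\Omega |\nabla u|^2\,dx\ge c\int_\Omega u^2/|x|^2\,dx$ for all $u\in C_c^\infty(\Omega)$. -/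

import Mathlib

open scoped ContDiff Gradient

noncomputable section

/-- Euclidean space `ℝⁿ`. -/
abbrev EucSp (n : ℕ) : Type := EuclideanSpace ℝ (Fin n)

/-- The unit vector `e_n` in the direction of the last coordinate. -/
def lastUnit (n : ℕ) (hn : 2 ≤ n) : EucSp n :=
  EuclideanSpace.single (⟨n - 1, by omega⟩ : Fin n) (1 : ℝ)

/-- A bounded domain: a bounded, open, connected (in particular nonempty) set. -/
def IsBoundedDomain {n : ℕ} (Ω : Set (EucSp n)) : Prop :=
  IsOpen Ω ∧ IsConnected Ω ∧ Bornology.IsBounded Ω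

/-- `B_ρ(-ρ e_n)` is an exterior ball of `Ω` at `0`. -/
def HasExteriorBall {n : ℕ} (hn : 2 ≤ n) (Ω : Set (EucSp n)) (ρ : ℝ) : Prop :=
  0 < ρ ∧ Metric.ball (-(ρ • lastUnit n hn)) ρ ⊆ (closure Ω)ᶜ

/-- Interior ball condition at `0`: some open ball of positive radius contained in `Ω`
has `0` on its bounding sphere. -/
def HasInteriorBall {n : ℕ} (Ω : Set (EucSp n)) : Prop :=
  ∃ (y : EucSp n) (r : ℝ), 0 < r ∧ ‖y‖ = r ∧ Metric.ball y r ⊆ Ω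

/-- `D = sup_{x ∈ Ω} |x|`. -/
def maxNorm {n : ℕ} (Ω : Set (EucSp n)) : ℝ :=
  sSup ((fun x : EucSp n => ‖x‖) '' Ω)

/-- `u ∈ C_c^∞(Ω)`. -/
def IsTestFunction {n : ℕ} (Ω : Set (EucSp n)) (u : EucSp n → ℝ) : Prop :=
  ContDiff ℝ ∞ u ∧ HasCompactSupport u ∧ tsupport u ⊆ Ω

/-- The Hardy inequality on `Ω` with constant `c`, singularity at `0`. -/
def HardyInequality {n : ℕ} (Ω : Set (EucSp n)) (c : ℝ) : Prop :=
  ∀ u : EucSp n → ℝ, IsTestFunction Ω u →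
    c * ∫ x in Ω, u x ^ 2 / ‖x‖ ^ 2 ≤ ∫ x in Ω, ‖∇ u x‖ ^ 2

end

open MeasureTheory Set Filter Topology

/-! On the half space, `φ = ⟨e, x⟩ |x|^{-n/2}` satisfies `-Δφ = (n²/4) φ / |x|²`, and a positive
supersolution of this equation gives the Hardy inequality: integrate `|∇u - u ∇φ/φ|² ≥ 0` by parts.
Outside the exterior ball, `⟨e, x⟩` is replaced by `w = ⟨e, x⟩ + ε |x|²` with `ε = 1/(2ρ)`, which is
positive exactly there. The curvature produces errors of order `ε`. The correction `w - κ w²`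
cancels the leading one, and the factor `exp (-δ |x|)` absorbs the rest as long as `δ |x| ≤ 1/2`;
this is the smallness of `D / ρ`. The computation is `supersolution_scalar_inequality`, used in
`hardyInequality_of_paraboloid`.

For sharpness, dilating test functions into the interior ball transfers any Hardy constant `c` to a
half space (`HardyInequality.halfSpace`). Testing there with `⟨ν, x⟩ k(|x|)` and averaging over
directions leaves `c ∫ k² ≤ ∫ (r k')²` over the whole space
(`integral_radial_le_of_hardy_halfSpace`). The profiles `k = r^{-n/2} θ(r^q)` satisfy `r k' ≈ -(n/2)
k` as `q → 0`, which forces `c ≤ n²/4`. -/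

/-! ### Integration by parts and the vector field method -/

/-- Euler's identity in integrated form: the divergence of `α(x) x` has integral zero. -/
lemma integral_fderiv_self_add_eq_zero {n : ℕ} {α : EucSp n → ℝ} (hα : ContDiff ℝ 1 α)
    (hc : HasCompactSupport α) :
    ∫ x, (fderiv ℝ α x x + n * α x) = 0 := by
  have hd : Continuous (fderiv ℝ α) := hα.continuous_fderiv one_ne_zero
  have hdc : HasCompactSupport (fderiv ℝ α) := hc.fderiv (𝕜 := ℝ)
  have hI : ∀ i : Fin n, Integrable
      (fun x : EucSp n => x i * fderiv ℝ α x (EuclideanSpace.single i 1)) := by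
    intro i
    apply Continuous.integrable_of_hasCompactSupport
    · fun_prop
    · apply HasCompactSupport.mul_left
      exact hdc.comp_left (g := fun L : EucSp n →L[ℝ] ℝ => L (EuclideanSpace.single i 1)) (by simp)
  have hαI : Integrable α := hα.continuous.integrable_of_hasCompactSupport hc
  have key : ∀ i : Fin n,
      ∫ x : EucSp n, x i * fderiv ℝ α x (EuclideanSpace.single i 1) = -∫ x, α x := by
    intro i
    have hf : ∀ x : EucSp n, fderiv ℝ (fun y : EucSp n => y i) x = EuclideanSpace.proj i := by
      intro x
      exact (EuclideanSpace.proj (𝕜 := ℝ) i).fderiv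
    have h := integral_mul_fderiv_eq_neg_fderiv_mul_of_integrable (μ := (volume : Measure (EucSp n)))
      (f := fun y : EucSp n => y i) (g := α) (v := EuclideanSpace.single i 1)
      (by simpa [hf] using hαI) (hI i)
      ((by fun_prop : Continuous fun x : EucSp n => x i * α x).integrable_of_hasCompactSupport
        hc.mul_left)
      (fun x _ => (EuclideanSpace.proj (𝕜 := ℝ) i).differentiableAt)
      (fun x _ => hα.differentiable one_ne_zero x)
    rw [h]
    simp [hf]
  have hsum : ∀ x : EucSp n, fderiv ℝ α x x
      = ∑ i, x i * fderiv ℝ α x (EuclideanSpace.single i 1) := by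
    intro x
    have h := congrArg (fderiv ℝ α x) ((EuclideanSpace.basisFun (Fin n) ℝ).sum_repr x)
    rw [map_sum] at h
    simpa using h.symm
  simp_rw [hsum]
  rw [integral_add (integrable_finsetSum _ fun i _ => hI i) (hαI.const_mul _),
    integral_finsetSum _ (fun i _ => hI i), integral_const_mul]
  simp [key]

lemma integral_fderiv_apply_eq_zero {n : ℕ} {β : EucSp n → ℝ} (hβ : ContDiff ℝ 1 β)
    (hc : HasCompactSupport β) (e : EucSp n) : ∫ x, fderiv ℝ β x e = 0 := by
  have hd : Continuous (fderiv ℝ β) := hβ.continuous_fderiv one_ne_zero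
  have hdc : HasCompactSupport (fun x => fderiv ℝ β x e) := hc.fderiv_apply (𝕜 := ℝ) e
  have hcont : Continuous (fun x => fderiv ℝ β x e) := by fun_prop
  have h := integral_mul_fderiv_eq_neg_fderiv_mul_of_integrable (μ := (volume : Measure (EucSp n)))
      (f := fun _ : EucSp n => (1 : ℝ)) (g := β) (v := e) (by simp)
      (by simpa using hcont.integrable_of_hasCompactSupport hdc)
      (by simpa using hβ.continuous.integrable_of_hasCompactSupport hc)
      (fun x _ => differentiableAt_const _)
      (fun x _ => hβ.differentiable one_ne_zero x)
  simpa using h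

/-- Off `tsupport u` the product vanishes locally. This admits coefficients that are singular
outside the support of the test function. -/
lemma contDiff_mul_of_tsupport {n : ℕ} {k : WithTop ℕ∞} {u A : EucSp n → ℝ} (hu : ContDiff ℝ k u)
    (hA : ∀ x ∈ tsupport u, ContDiffAt ℝ k A x) : ContDiff ℝ k (fun x => u x * A x) := by
  refine contDiff_iff_contDiffAt.2 fun x => ?_
  by_cases hx : x ∈ tsupport u
  · exact hu.contDiffAt.mul (hA x hx)
  · refine (contDiffAt_const (c := (0 : ℝ))).congr_of_eventuallyEq ?_
    filter_upwards [notMem_tsupport_iff_eventuallyEq.1 hx] with y hy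
    simp [hy]

lemma norm_gradient {n : ℕ} (u : EucSp n → ℝ) (x : EucSp n) : ‖∇ u x‖ = ‖fderiv ℝ u x‖ := by
  rw [gradient, LinearIsometryEquiv.norm_map]

lemma integrable_norm_gradient_sq {n : ℕ} {u : EucSp n → ℝ} (hu : ContDiff ℝ 1 u)
    (hc : HasCompactSupport u) : Integrable (fun x => ‖∇ u x‖ ^ 2) := by
  simp_rw [norm_gradient]
  have hd : Continuous (fderiv ℝ u) := hu.continuous_fderiv one_ne_zero
  apply Continuous.integrable_of_hasCompactSupport (by fun_prop)
  exact (hc.fderiv (𝕜 := ℝ)).comp_left (g := fun L : EucSp n →L[ℝ] ℝ => ‖L‖ ^ 2) (by simp)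

/-- The vector field method for weighted `L²` inequalities, for fields `A(x) x + p(x) e`. -/
lemma integral_mul_sq_le_of_field {n : ℕ} {u A p V : EucSp n → ℝ} {e : EucSp n}
    (hu : ContDiff ℝ 1 u) (hc : HasCompactSupport u)
    (hA : ∀ x ∈ tsupport u, ContDiffAt ℝ 1 A x) (hp : ∀ x ∈ tsupport u, ContDiffAt ℝ 1 p x)
    (hV : Integrable (fun x => V x * u x ^ 2))
    (h : ∀ x ∈ tsupport u, fderiv ℝ A x x + n * A x + fderiv ℝ p x e
      + ‖A x • x + p x • e‖ ^ 2 ≤ - V x) :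
    ∫ x, V x * u x ^ 2 ≤ ∫ x, ‖∇ u x‖ ^ 2 := by
  have hts : tsupport (fun x => u x ^ 2) ⊆ tsupport u :=
    closure_mono fun x hx => by
      simp only [Function.mem_support] at hx ⊢
      exact fun h0 => hx (by simp [h0])
  have hu2 : ContDiff ℝ 1 (fun x => u x ^ 2) := hu.pow 2
  have hc2 : HasCompactSupport (fun x => u x ^ 2) := hc.comp_left (g := fun t : ℝ => t ^ 2) (by simp)
  have hα := contDiff_mul_of_tsupport hu2 fun x hx => hA x (hts hx)
  have hβ := contDiff_mul_of_tsupport hu2 fun x hx => hp x (hts hx)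
  have hαc : HasCompactSupport (fun x => u x ^ 2 * A x) := hc2.mul_right
  have hβc : HasCompactSupport (fun x => u x ^ 2 * p x) := hc2.mul_right
  have h1 := integral_fderiv_self_add_eq_zero hα hαc
  have h2 := integral_fderiv_apply_eq_zero hβ hβc e
  have hdα := hα.continuous_fderiv one_ne_zero
  have hdβ := hβ.continuous_fderiv one_ne_zero
  have hI1 : Integrable (fun x => fderiv ℝ (fun x => u x ^ 2 * A x) x x + n * (u x ^ 2 * A x)) := by
    have := hα.continuous
    apply Continuous.integrable_of_hasCompactSupport (by fun_prop)
    apply HasCompactSupport.add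
    · refine (hαc.fderiv (𝕜 := ℝ)).mono fun x hx => ?_
      simp only [Function.mem_support] at hx ⊢
      exact fun h0 => hx (by simp [h0])
    · exact hαc.mul_left
  have hI2 : Integrable (fun x => fderiv ℝ (fun x => u x ^ 2 * p x) x e) :=
    Continuous.integrable_of_hasCompactSupport (by fun_prop) (hβc.fderiv_apply (𝕜 := ℝ) e)
  have hI3 := integrable_norm_gradient_sq hu hc
  have : ∫ x, V x * u x ^ 2 ≤ ∫ x, (‖∇ u x‖ ^ 2
      - ((fderiv ℝ (fun x => u x ^ 2 * A x) x x + n * (u x ^ 2 * A x))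
        + fderiv ℝ (fun x => u x ^ 2 * p x) x e)) := by
    refine integral_mono hV (hI3.sub (hI1.add hI2)) fun x => ?_
    by_cases hx : x ∈ tsupport u
    · have hu' : HasFDerivAt u (fderiv ℝ u x) x := (hu.differentiable one_ne_zero x).hasFDerivAt
      have hA' := ((hA x hx).differentiableAt one_ne_zero).hasFDerivAt
      have hp' := ((hp x hx).differentiableAt one_ne_zero).hasFDerivAt
      have e1 := ((hu'.pow 2).mul hA').fderiv
      have e2 := ((hu'.pow 2).mul hp').fderiv
      have e1' : fderiv ℝ (fun x => u x ^ 2 * A x) x x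
          = u x ^ 2 * fderiv ℝ A x x + A x * (2 * u x * fderiv ℝ u x x) := by
        erw [e1]; simp
      have e2' : fderiv ℝ (fun x => u x ^ 2 * p x) x e
          = u x ^ 2 * fderiv ℝ p x e + p x * (2 * u x * fderiv ℝ u x e) := by
        erw [e2]; simp
      -- Expanding this square, with `F = A x + p e`, gives the pointwise bound `|∇u|² ≥ 2u ⟨∇u, F⟩
      -- - u²|F|²`; the right side is `div (u² F) - u² (div F + |F|²)`.
      have hsq := sq_nonneg ‖∇ u x - u x • (A x • x + p x • e)‖
      rw [norm_sub_sq_real, inner_smul_right, inner_add_right, inner_smul_right, inner_smul_right,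
        norm_smul, inner_gradient_left, inner_gradient_left, mul_pow, Real.norm_eq_abs, sq_abs]
        at hsq
      have h3 := mul_le_mul_of_nonneg_left (h x hx) (sq_nonneg (u x))
      simp only [e1', e2']
      linarith
    · have h0 : u x = 0 := image_eq_zero_of_notMem_tsupport hx
      have z1 : fderiv ℝ (fun x => u x ^ 2 * A x) x = 0 :=
        image_eq_zero_of_notMem_tsupport fun hh => hx
          (hts (tsupport_mul_subset_left (tsupport_fderiv_subset ℝ hh)))
      have z2 : fderiv ℝ (fun x => u x ^ 2 * p x) x = 0 :=
        image_eq_zero_of_notMem_tsupport fun hh => hx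
          (hts (tsupport_mul_subset_left (tsupport_fderiv_subset ℝ hh)))
      simp only [z1, z2, h0]
      simp
  have hsub := integral_sub hI3 (hI1.add hI2)
  simp only [Pi.add_apply] at hsub
  rw [hsub, integral_add hI1 hI2, h1, h2] at this
  simpa using this

/-! ### The supersolution for an exterior ball -/

/-- With `r = |x|` and `φ = (w - κ w²) |x|^{-n/2} exp (-δ |x|)`, the left side is `Δφ / φ`, written
as `div F + |F|²` for `F = ∇φ / φ`; it uses `|∇w|² = 1 + 4εw` and `Δw = 2nε`. The half space terms
add up to `-n²/4 / r²`, so only the perturbation terms need a sign. -/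
lemma supersolution_scalar_inequality {N ε r w κ δ p : ℝ} (hN : 2 ≤ N) (hε : 0 < ε) (hr : 0 < r)
    (hw : 0 < w) (hwr : w ≤ r + ε * r ^ 2) (hκ : κ = N * ε / 2) (hδ : δ = 8 * N ^ 2 * ε)
    (hδr : δ * r ≤ 1 / 2) (hp : p = (1 - 2 * κ * w) / (w - κ * w ^ 2)) :
    (-(2 * κ) / (w - κ * w ^ 2) - p ^ 2) * (1 + 4 * ε * w) + 2 * N * ε * p
      + (N - N ^ 2 / 2) / r ^ 2 + δ * (1 - N) / r + p ^ 2 * (1 + 4 * ε * w)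
      - 2 * p * (w + ε * r ^ 2) * (N / 2 / r ^ 2 + δ / r) + (N / 2 / r + δ) ^ 2
      ≤ -(N ^ 2 / 4 / r ^ 2) := by
  have hεr : ε * r ≤ 1 / 64 := by
    have : ε * r * 4 ≤ ε * r * N ^ 2 := by
      apply mul_le_mul_of_nonneg_left _ (by positivity); nlinarith
    rw [hδ] at hδr
    nlinarith
  have hw2 : w ≤ 2 * r := by nlinarith
  have hNεr : N * (ε * r) ≤ 1 / 32 := by
    have : (ε * r * N) * 2 ≤ ε * r * N * N := by
      apply mul_le_mul_of_nonneg_left hN (by positivity)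
    rw [hδ] at hδr
    nlinarith
  have hκ0 : 0 < κ := by rw [hκ]; positivity
  have hδ0 : 0 < δ := by rw [hδ]; positivity
  have hκw : κ * w ≤ 1 / 32 := by
    calc κ * w ≤ κ * (2 * r) := by gcongr
      _ = N * (ε * r) := by rw [hκ]; ring
      _ ≤ _ := hNεr
  set W := w - κ * w ^ 2 with hW
  have hWlow : 31 / 32 * w ≤ W := by rw [hW]; nlinarith
  have hW0 : 0 < W := by linarith
  set y := w / r with hy
  have hy0 : 0 < y := by positivity
  have hy2 : y ≤ 2 := by rw [hy, div_le_iff₀ hr]; exact hw2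
  have hwy : w = y * r := by rw [hy]; field_simp
  -- This is the remainder after multiplication by `W`. The choice `2κ = Nε` makes the first two
  -- terms cancel to leading order, and `-δ (W / r)`, comparable to `-δ y`, dominates the remaining
  -- positive terms.
  have hT : -2 * κ * (1 + 4 * ε * w) + N * ε * (1 - 2 * κ * w) + N * κ * y ^ 2
      + δ ^ 2 * W - δ * (W / r) + 2 * δ * κ * w * y - 2 * δ * ε * r * (1 - 2 * κ * w) ≤ 0 := by
    have t1 : -2 * κ * (1 + 4 * ε * w) + N * ε * (1 - 2 * κ * w) ≤ 0 := by
      have : N * ε = 2 * κ := by rw [hκ]; ring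
      rw [this]
      have : 0 ≤ κ * (ε * w) := by positivity
      have : 0 ≤ κ * (κ * w) := by positivity
      nlinarith
    have t2 : N * κ * y ^ 2 ≤ 1 / 8 * (δ * y) := by
      have : N * κ * y ^ 2 ≤ N * κ * (y * 2) := by
        rw [sq]; gcongr
      -- The factor 8 in `δ` is used here: with `y ≤ 2` this term costs only `δ y / 8`, while half
      -- of `δ (W / r)` is still available after `t3`.
      have e : δ = 16 * (N * κ) := by rw [hδ, hκ]; ring
      rw [e]; linarith
    have t3 : δ ^ 2 * W ≤ 1 / 2 * (δ * (W / r)) := by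
      have e : δ ^ 2 * W = (δ * r) * (δ * (W / r)) := by field_simp
      rw [e]
      gcongr
    have t4 : δ * (31 / 32 * y) ≤ δ * (W / r) := by
      gcongr
      rw [le_div_iff₀ hr]
      calc 31 / 32 * y * r = 31 / 32 * w := by rw [hwy]; ring
        _ ≤ W := hWlow
    have t5 : 2 * δ * κ * w * y ≤ 1 / 16 * (δ * y) := by
      have := mul_le_mul_of_nonneg_left hκw (by positivity : 0 ≤ 2 * (δ * y))
      linarith
    have t6 : 0 ≤ 2 * δ * ε * r * (1 - 2 * κ * w) := by
      have : 0 ≤ 1 - 2 * κ * w := by linarith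
      positivity
    have : 0 < δ * y := by positivity
    linarith
  have hfin : (-(2 * κ) / W - p ^ 2) * (1 + 4 * ε * w) + 2 * N * ε * p
      + (N - N ^ 2 / 2) / r ^ 2 + δ * (1 - N) / r + p ^ 2 * (1 + 4 * ε * w)
      - 2 * p * (w + ε * r ^ 2) * (N / 2 / r ^ 2 + δ / r) + (N / 2 / r + δ) ^ 2
      + (N ^ 2 / 4 / r ^ 2) = (-2 * κ * (1 + 4 * ε * w) + N * ε * (1 - 2 * κ * w) + N * κ * y ^ 2
      + δ ^ 2 * W - δ * (W / r) + 2 * δ * κ * w * y - 2 * δ * ε * r * (1 - 2 * κ * w)) / W := by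
    have hWe : W ≠ 0 := hW0.ne'
    rw [hp, hy]
    field_simp
    rw [hW]
    ring
  have := div_nonpos_of_nonpos_of_nonneg hT hW0.le
  rw [← hfin] at this
  linarith

lemma integrable_sq_div_norm_sq {n : ℕ} {u : EucSp n → ℝ} (hu : Continuous u)
    (hc : HasCompactSupport u) (h0 : (0 : EucSp n) ∉ tsupport u) :
    Integrable (fun x => u x ^ 2 / ‖x‖ ^ 2) := by
  apply Continuous.integrable_of_hasCompactSupport
  · refine continuous_iff_continuousAt.2 fun x => ?_
    by_cases hx : x ∈ tsupport u
    · have : ‖x‖ ^ 2 ≠ 0 := by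
        have : x ≠ 0 := fun h => h0 (h ▸ hx)
        positivity
      exact ContinuousAt.div (by fun_prop) (by fun_prop) this
    · refine (continuousAt_const (y := (0 : ℝ))).congr ?_
      filter_upwards [notMem_tsupport_iff_eventuallyEq.1 hx] with y hy
      simp [hy]
  · refine hc.mono fun x hx => ?_
    simp only [Function.mem_support] at hx ⊢
    exact fun h => hx (by simp [h])

lemma setIntegral_sq_div_norm_sq {n : ℕ} {Ω : Set (EucSp n)} {u : EucSp n → ℝ}
    (h : tsupport u ⊆ Ω) : ∫ x in Ω, u x ^ 2 / ‖x‖ ^ 2 = ∫ x, u x ^ 2 / ‖x‖ ^ 2 :=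
  setIntegral_eq_integral_of_forall_compl_eq_zero fun x hx => by
    rw [image_eq_zero_of_notMem_tsupport fun hh => hx (h hh)]; simp

lemma setIntegral_norm_gradient_sq {n : ℕ} {Ω : Set (EucSp n)} {u : EucSp n → ℝ}
    (h : tsupport u ⊆ Ω) : ∫ x in Ω, ‖∇ u x‖ ^ 2 = ∫ x, ‖∇ u x‖ ^ 2 :=
  setIntegral_eq_integral_of_forall_compl_eq_zero fun x hx => by
    have : fderiv ℝ u x = 0 :=
      image_eq_zero_of_notMem_tsupport fun hh => hx (h (tsupport_fderiv_subset ℝ hh))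
    rw [norm_gradient, this]; simp

lemma hasFDerivAt_norm_sq_euclidean {n : ℕ} (x : EucSp n) :
    HasFDerivAt (fun x : EucSp n => ‖x‖ ^ 2) ((2 : ℝ) • innerSL ℝ x) x :=
  (hasStrictFDerivAt_norm_sq x).hasFDerivAt.congr_fderiv (by rw [two_smul, two_smul])

/-- If `⟨x, e⟩ + ε |x|² > 0` on `Ω`, and `Ω` is small compared with `1 / ε`, then the Hardy
inequality on `Ω` holds with the constant of the half space. The field used is the logarithmic
gradient of `(w - κ w²) |x|^{-n/2} exp (-δ |x|)`, where `w = ⟨x, e⟩ + ε |x|²`. -/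
lemma hardyInequality_of_paraboloid {n : ℕ} (hn : 2 ≤ n) {Ω : Set (EucSp n)} {e : EucSp n}
    (he : ‖e‖ = 1) {ε : ℝ} (hε : 0 < ε) (hw : ∀ x ∈ Ω, 0 < inner ℝ e x + ε * ‖x‖ ^ 2)
    (hsmall : ∀ x ∈ Ω, 8 * (n : ℝ) ^ 2 * ε * ‖x‖ ≤ 1 / 2) :
    HardyInequality Ω ((n : ℝ) ^ 2 / 4) := by
  intro u ⟨hu, hc, hts⟩
  have h0 : (0 : EucSp n) ∉ Ω := fun h => by simpa using hw 0 h
  rw [setIntegral_sq_div_norm_sq hts, setIntegral_norm_gradient_sq hts, ← integral_const_mul]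
  have hu1 : ContDiff ℝ 1 u := hu.of_le (by exact_mod_cast le_top)
  set κ : ℝ := n * ε / 2 with hκ
  set δ : ℝ := 8 * (n : ℝ) ^ 2 * ε with hδ
  have hN : (2 : ℝ) ≤ n := by exact_mod_cast hn
  let w : EucSp n → ℝ := fun x => inner ℝ e x + ε * ‖x‖ ^ 2
  -- The field is `P(w) ∇w - Q(|x|²) x` with `∇w = e + 2εx`. `P` is the logarithmic derivative of `t
  -- - κ t²`, and `Q` collects the two radial factors as a function of `|x|²`.
  let P : ℝ → ℝ := fun t => (1 - 2 * κ * t) / (t - κ * t ^ 2)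
  let Q : ℝ → ℝ := fun s => n / 2 / s + δ / √s
  let p : EucSp n → ℝ := fun x => P (w x)
  let A : EucSp n → ℝ := fun x => 2 * ε * p x - Q (‖x‖ ^ 2)
  have hwn : ∀ x : EucSp n, w x ≤ ‖x‖ + ε * ‖x‖ ^ 2 := fun x => by
    have := real_inner_le_norm e x
    rw [he, one_mul] at this
    simp only [w]; linarith
  have hW : ∀ x ∈ Ω, 0 < w x - κ * w x ^ 2 := by
    intro x hx
    have h1 := hw x hx
    have h2 := hwn x
    have h3 := hsmall x hx
    have h4 : ε * ‖x‖ * 4 ≤ ε * ‖x‖ * (n : ℝ) ^ 2 := by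
      apply mul_le_mul_of_nonneg_left _ (by positivity); nlinarith
    have h5 : w x ≤ 2 * ‖x‖ := by
      have : ε * ‖x‖ ≤ 1 := by rw [hδ] at h3; nlinarith
      nlinarith [norm_nonneg x]
    have h6 : κ * w x ≤ 1 / 2 := by
      have : κ * w x ≤ κ * (2 * ‖x‖) := by
        apply mul_le_mul_of_nonneg_left h5; positivity
      have h7 : (n : ℝ) * (ε * ‖x‖) ≤ (n : ℝ) ^ 2 * (ε * ‖x‖) := by
        apply mul_le_mul_of_nonneg_right _ (by positivity); nlinarith
      rw [hκ] at this ⊢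
      rw [hδ] at h3
      nlinarith
    have : w x - κ * w x ^ 2 = w x * (1 - κ * w x) := by ring
    rw [this]
    apply mul_pos h1; linarith
  have hx0 : ∀ x ∈ Ω, 0 < ‖x‖ := fun x hx => norm_pos_iff.2 fun h => h0 (h ▸ hx)
  have hwc : ContDiff ℝ 1 w := by
    have : ContDiff ℝ 1 (fun x : EucSp n => ‖x‖ ^ 2) := contDiff_norm_sq ℝ
    exact (contDiff_const.inner ℝ contDiff_id).add (contDiff_const.mul this)
  have hpc : ∀ x ∈ Ω, ContDiffAt ℝ 1 p x := fun x hx =>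
    ContDiffAt.div (contDiffAt_const.sub (contDiffAt_const.mul hwc.contDiffAt))
      (hwc.contDiffAt.sub (contDiffAt_const.mul (hwc.contDiffAt.pow 2))) (hW x hx).ne'
  have hAc : ∀ x ∈ Ω, ContDiffAt ℝ 1 A x := fun x hx => by
    have hs : ContDiffAt ℝ 1 (fun x : EucSp n => ‖x‖ ^ 2) x := (contDiff_norm_sq ℝ).contDiffAt
    have hne : ‖x‖ ^ 2 ≠ 0 := by have := hx0 x hx; positivity
    have hne' : √(‖x‖ ^ 2) ≠ 0 := by have := hx0 x hx; positivity
    exact (contDiffAt_const.mul (hpc x hx)).sub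
      ((contDiffAt_const.div hs hne).add (contDiffAt_const.div (hs.sqrt hne) hne'))
  have hInt := integrable_sq_div_norm_sq hu.continuous hc fun h => h0 (hts h)
  have main := integral_mul_sq_le_of_field (A := A) (p := p) (e := e)
    (V := fun x => (n : ℝ) ^ 2 / 4 / ‖x‖ ^ 2) hu1 hc (fun x hx => hAc x (hts hx))
    (fun x hx => hpc x (hts hx)) (by
      refine (hInt.const_mul ((n : ℝ) ^ 2 / 4)).congr (Eventually.of_forall fun x => ?_)
      simp only; ring) ?_
  · refine le_trans (le_of_eq (integral_congr_ae (Eventually.of_forall fun x => ?_))) main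
    simp only; ring
  intro x hx
  have hxΩ := hts hx
  have hr := hx0 x hxΩ
  have hWx := hW x hxΩ
  have hw' : HasFDerivAt w (innerSL ℝ e + ε • ((2 : ℝ) • innerSL ℝ x)) x := by
    exact (innerSL ℝ e).hasFDerivAt.add ((hasFDerivAt_norm_sq_euclidean x).const_mul ε)
  have hP' : HasDerivAt P (-(2 * κ) / (w x - κ * w x ^ 2) - P (w x) ^ 2) (w x) := by
    have h1 : HasDerivAt (fun t : ℝ => 1 - 2 * κ * t) (-(2 * κ)) (w x) := by
      simpa using ((hasDerivAt_id (w x)).const_mul (2 * κ)).const_sub 1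
    have h2 : HasDerivAt (fun t : ℝ => t - κ * t ^ 2) (1 - 2 * κ * w x) (w x) := by
      refine ((hasDerivAt_id (w x)).sub (((hasDerivAt_id (w x)).pow 2).const_mul κ)).congr_deriv ?_
      simp; ring
    refine (h1.div h2 hWx.ne').congr_deriv ?_
    simp only [P]
    field_simp
  have hQ' : HasDerivAt Q (-(n / 2) / (‖x‖ ^ 2) ^ 2 - δ / (2 * ‖x‖ ^ 3)) (‖x‖ ^ 2) := by
    have hne : ‖x‖ ^ 2 ≠ 0 := by positivity
    have hsq : √(‖x‖ ^ 2) = ‖x‖ := Real.sqrt_sq hr.le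
    have h1 : HasDerivAt (fun s : ℝ => (n : ℝ) / 2 / s) (-(n / 2) / (‖x‖ ^ 2) ^ 2) (‖x‖ ^ 2) := by
      refine ((hasDerivAt_const (‖x‖ ^ 2) ((n : ℝ) / 2)).div
        (hasDerivAt_id (‖x‖ ^ 2)) hne).congr_deriv ?_
      simp
    have h2 : HasDerivAt (fun s : ℝ => δ / √s) (-(δ / (2 * ‖x‖ ^ 3))) (‖x‖ ^ 2) := by
      refine ((hasDerivAt_const (‖x‖ ^ 2) δ).div ((hasDerivAt_id (‖x‖ ^ 2)).sqrt hne)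
        (by simp [hr.ne'])).congr_deriv ?_
      simp [hsq]
      field_simp
    refine (h1.add h2).congr_deriv ?_
    ring
  have hp' : HasFDerivAt p ((-(2 * κ) / (w x - κ * w x ^ 2) - P (w x) ^ 2) •
      (innerSL ℝ e + ε • ((2 : ℝ) • innerSL ℝ x))) x := hP'.comp_hasFDerivAt x hw'
  have hQs : HasFDerivAt (fun x : EucSp n => Q (‖x‖ ^ 2))
      ((-(n / 2) / (‖x‖ ^ 2) ^ 2 - δ / (2 * ‖x‖ ^ 3)) • ((2 : ℝ) • innerSL ℝ x)) x :=
    HasDerivAt.comp_hasFDerivAt (h₂ := Q) x hQ' (hasFDerivAt_norm_sq_euclidean x)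
  have hA' : HasFDerivAt A _ x := (hp'.const_mul (2 * ε)).sub hQs
  have hQx : Q (‖x‖ ^ 2) = n / 2 / ‖x‖ ^ 2 + δ / ‖x‖ := by
    simp only [Q]; rw [Real.sqrt_sq hr.le]
  have hnorm : ‖A x • x + p x • e‖ ^ 2
      = A x ^ 2 * ‖x‖ ^ 2 + 2 * (A x * p x) * inner ℝ e x + p x ^ 2 := by
    rw [norm_add_sq_real, norm_smul, norm_smul, inner_smul_left, inner_smul_right, he,
      mul_pow, mul_pow, Real.norm_eq_abs, Real.norm_eq_abs, sq_abs, sq_abs, real_inner_comm x e]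
    simp; ring
  have hsc := supersolution_scalar_inequality (p := P (w x)) hN hε hr (hw x hxΩ) (hwn x) hκ hδ
    (hsmall x hxΩ) rfl
  rw [hnorm, hA'.fderiv, hp'.fderiv]
  refine le_trans (le_of_eq ?_) hsc
  have hin : inner ℝ e x = w x - ε * ‖x‖ ^ 2 := by simp only [w]; ring
  have hpx : p x = P (w x) := rfl
  simp only [sub_apply, smul_apply,
    add_apply, innerSL_apply_apply, smul_eq_mul,
    real_inner_self_eq_norm_sq, he, A, hQx, hpx, real_inner_comm e x]
  rw [show inner ℝ e x + ε * ‖x‖ ^ 2 = w x from rfl, hin]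
  generalize P (w x) = q
  generalize hg : w x - κ * w x ^ 2 = g at *
  generalize w x = v
  field_simp
  ring

/-- Completing the square gives `|x + ρe|² - ρ² = 2ρ (⟨e, x⟩ + |x|² / (2ρ))`, so lying outside the
exterior ball is positivity of `w` with `ε = 1/(2ρ)`. -/
lemma hardyInequality_of_exteriorBall {n : ℕ} (hn : 2 ≤ n) {Ω : Set (EucSp n)} {ρ : ℝ}
    (ho : IsOpen Ω) (hb : Bornology.IsBounded Ω) (hext : HasExteriorBall hn Ω ρ)
    (hρ : maxNorm Ω / (1 / (8 * (n : ℝ) ^ 2)) ≤ ρ) :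
    HardyInequality Ω ((n : ℝ) ^ 2 / 4) := by
  obtain ⟨hρ0, hball⟩ := hext
  have he : ‖lastUnit n hn‖ = 1 := by simp [lastUnit]
  have hnorm : ∀ x : EucSp n, ‖x + ρ • lastUnit n hn‖ ^ 2
      = 2 * ρ * (inner ℝ (lastUnit n hn) x + 1 / (2 * ρ) * ‖x‖ ^ 2) + ρ ^ 2 := by
    intro x
    rw [norm_add_sq_real, norm_smul, he, inner_smul_right, real_inner_comm, Real.norm_eq_abs,
      mul_one, sq_abs]
    field_simp
    ring
  have hge : ∀ x ∈ Ω, 0 ≤ inner ℝ (lastUnit n hn) x + 1 / (2 * ρ) * ‖x‖ ^ 2 := by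
    intro x hx
    by_contra! hneg
    refine hball (a := x) ?_ (subset_closure hx)
    rw [Metric.mem_ball, dist_eq_norm, sub_neg_eq_add]
    refine lt_of_pow_lt_pow_left₀ 2 hρ0.le ?_
    rw [hnorm]
    have := mul_neg_of_pos_of_neg (by positivity : 0 < 2 * ρ) hneg
    linarith
  refine hardyInequality_of_paraboloid hn he (ε := 1 / (2 * ρ)) (by positivity) ?_ ?_
  · intro x hx
    refine lt_of_le_of_ne (hge x hx) fun heq => ?_
    have hx1 : ‖x + ρ • lastUnit n hn‖ = ρ := by
      have := hnorm x
      rw [← heq, mul_zero, zero_add] at this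
      exact (pow_left_inj₀ (norm_nonneg _) hρ0.le two_ne_zero).1 this
    -- Equality would put a point of `Ω` on the sphere; `Ω` is open, so it would then meet the ball
    -- itself.
    have hcl : x ∈ closure (Metric.ball (-(ρ • lastUnit n hn)) ρ) := by
      rw [closure_ball _ hρ0.ne', Metric.mem_closedBall, dist_eq_norm, sub_neg_eq_add, hx1]
    obtain ⟨z, hzΩ, hz⟩ := mem_closure_iff.1 hcl Ω ho hx
    exact hball hz (subset_closure hzΩ)
  · intro x hx
    have hx1 : ‖x‖ ≤ maxNorm Ω := by
      obtain ⟨R, hR⟩ := hb.exists_norm_le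
      exact le_csSup ⟨R, by rintro _ ⟨z, hz, rfl⟩; exact hR z hz⟩ ⟨x, hx, rfl⟩
    have hn0 : (0 : ℝ) < n := by exact_mod_cast (by omega : 0 < n)
    rw [div_div_eq_mul_div, div_one] at hρ
    have : 8 * (n : ℝ) ^ 2 * ‖x‖ ≤ ρ := by
      refine le_trans ?_ hρ
      rw [mul_comm]
      gcongr
    calc 8 * (n : ℝ) ^ 2 * (1 / (2 * ρ)) * ‖x‖ = (8 * (n : ℝ) ^ 2 * ‖x‖) / (2 * ρ) := by ring
      _ ≤ ρ / (2 * ρ) := by gcongr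
      _ = 1 / 2 := by field_simp

/-! ### Sharpness: blow-up to the half space -/

/-- By scaling, a Hardy constant of a domain with an interior ball at `0` is a Hardy constant of
the half space. -/
lemma HardyInequality.halfSpace {n : ℕ} {Ω : Set (EucSp n)} {c r : ℝ} {y : EucSp n}
    (hH : HardyInequality Ω c) (hy : ‖y‖ = r) (hball : Metric.ball y r ⊆ Ω)
    {u : EucSp n → ℝ} (hu : IsTestFunction {x | 0 < inner ℝ y x} u) :
    c * ∫ x, u x ^ 2 / ‖x‖ ^ 2 ≤ ∫ x, ‖∇ u x‖ ^ 2 := by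
  obtain ⟨hu, hc, hts⟩ := hu
  obtain ⟨m, hm, hmle⟩ := hc.isCompact.exists_forall_le' (f := fun x => inner ℝ y x)
    (by fun_prop) (a := 0) hts
  obtain ⟨M, hM⟩ := hc.isCompact.exists_bound_of_continuousOn (f := fun x : EucSp n => ‖x‖ ^ 2)
    (by fun_prop)
  obtain ⟨t, ht, htx⟩ : ∃ t : ℝ, 0 < t ∧ ∀ x ∈ tsupport u, t • x ∈ Metric.ball y r := by
    -- For `t > 0`, `t x` lies in the ball exactly when `t |x|² < 2 ⟨y, x⟩`. On the support `⟨y, x⟩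
    -- ≥ m` and `|x|² ≤ |M| + 1`, so this `t` gives `t |x|² ≤ m < 2m`.
    refine ⟨m / (|M| + 1), by positivity, fun x hx => ?_⟩
    have hr0 : 0 ≤ r := hy ▸ norm_nonneg y
    rw [Metric.mem_ball, dist_eq_norm]
    refine lt_of_pow_lt_pow_left₀ 2 hr0 ?_
    rw [norm_sub_sq_real, norm_smul, mul_pow, inner_smul_left, hy, real_inner_comm]
    have ht : 0 < m / (|M| + 1) := by positivity
    set t := m / (|M| + 1) with htdef
    have h1 : t * ‖x‖ ^ 2 < 2 * inner ℝ y x := by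
      have h2 : ‖x‖ ^ 2 ≤ |M| + 1 := by
        have := hM x hx
        rw [Real.norm_of_nonneg (by positivity)] at this
        linarith [le_abs_self M]
      have h3 : t * ‖x‖ ^ 2 ≤ m := by
        calc t * ‖x‖ ^ 2 ≤ t * (|M| + 1) := by gcongr
          _ = m := by rw [htdef]; field_simp
      linarith [hmle x hx]
    have h4 := mul_lt_mul_of_pos_left h1 ht
    simp only [Real.norm_eq_abs, sq_abs, conj_trivial]
    nlinarith
  set s := t⁻¹ with hs
  have hs0 : 0 < s := inv_pos.2 ht
  let v : EucSp n → ℝ := fun x => u (s • x)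
  have hvts : tsupport v ⊆ Ω := by
    have : tsupport v = (fun x => s • x) ⁻¹' tsupport u :=
      tsupport_comp_eq_preimage u (Homeomorph.smulOfNeZero s hs0.ne')
    rw [this]
    intro x hx
    have := htx _ hx
    rw [smul_smul, hs, mul_inv_cancel₀ ht.ne', one_smul] at this
    exact hball this
  have hv : IsTestFunction Ω v :=
    ⟨hu.comp (contDiff_const_smul s),
      hc.comp_homeomorph (Homeomorph.smulOfNeZero s hs0.ne'), hvts⟩
  have h := hH v hv
  rw [setIntegral_sq_div_norm_sq hvts, setIntegral_norm_gradient_sq hvts] at h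
  have hgrad : ∀ x, ‖∇ v x‖ ^ 2 = s ^ 2 * ‖∇ u (s • x)‖ ^ 2 := by
    intro x
    rw [norm_gradient, norm_gradient]
    have : fderiv ℝ v x = s • fderiv ℝ u (s • x) := fderiv_comp_smul s
    rw [this, norm_smul, mul_pow, Real.norm_eq_abs, sq_abs]
  have hpot : ∀ x, v x ^ 2 / ‖x‖ ^ 2 = s ^ 2 * (u (s • x) ^ 2 / ‖s • x‖ ^ 2) := by
    intro x
    rw [norm_smul, mul_pow, Real.norm_eq_abs, sq_abs]
    by_cases hx : ‖x‖ = 0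
    · simp [hx]
    · simp only [v]; field_simp
  -- Both integrals scale by the same factor `s² |s^{-n}|`, so the constant `c` is unchanged.
  simp_rw [hgrad, hpot] at h
  rw [integral_const_mul, integral_const_mul,
    Measure.integral_comp_smul volume (fun x => u x ^ 2 / ‖x‖ ^ 2),
    Measure.integral_comp_smul volume (fun x => ‖∇ u x‖ ^ 2), smul_eq_mul, smul_eq_mul] at h
  have hpos : 0 < s ^ 2 * |(s ^ Module.finrank ℝ (EucSp n))⁻¹| := by positivity
  refine le_of_mul_le_mul_left ?_ hpos
  linarith

/-! ### Test functions vanishing linearly on the boundary -/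

/-- Smooth approximations of `s ↦ max s 0`, vanishing near `s ≤ 0`, with bounded derivatives. -/
lemma exists_smooth_cutoff_of_pos : ∃ (g : ℕ → ℝ → ℝ) (g' : ℕ → ℝ → ℝ) (C : ℝ),
    (∀ m, ContDiff ℝ ∞ (g m)) ∧ (∀ m s, HasDerivAt (g m) (g' m s) s) ∧
    (∀ m s, |g m s| ≤ |s|) ∧ (∀ m s, |g' m s| ≤ C) ∧
    (∀ m s, g m s ≠ 0 → 1 ≤ m * s) ∧
    (∀ m : ℕ, ∀ s : ℝ, 2 < m * s → g m s = s ∧ g' m s = 1) := by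
  let G := Real.smoothTransition
  have hG : ContDiff ℝ ∞ G := Real.smoothTransition.contDiff
  -- `K` is the derivative of `t G(t - 1)`. Since `g m s = s G(m s - 1)` is a rescaling of it, `g' m
  -- s = K(m s)`, and a bound for `K` is uniform in `m`.
  let K : ℝ → ℝ := fun t => G (t - 1) + t * deriv G (t - 1)
  have hd : Continuous (deriv G) := hG.continuous_deriv (by exact_mod_cast le_top)
  have hKc : Continuous K := by
    have := hG.continuous
    fun_prop
  have hK0 : ∀ t < 1, K t = 0 := by
    intro t ht
    have h1 : G =ᶠ[𝓝 (t - 1)] fun _ => 0 := by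
      filter_upwards [gt_mem_nhds (show t - 1 < 0 by linarith)] with z hz
      exact Real.smoothTransition.zero_of_nonpos hz.le
    simp only [K]
    rw [h1.deriv_eq, h1.eq_of_nhds]
    simp
  have hK1 : ∀ t, 2 < t → K t = 1 := by
    intro t ht
    have h1 : G =ᶠ[𝓝 (t - 1)] fun _ => 1 := by
      filter_upwards [lt_mem_nhds (show 1 < t - 1 by linarith)] with z hz
      exact Real.smoothTransition.one_of_one_le hz.le
    simp only [K]
    rw [h1.deriv_eq, h1.eq_of_nhds]
    simp
  obtain ⟨C, hC⟩ := isCompact_Icc.exists_bound_of_continuousOn (s := Icc (0 : ℝ) 3) (f := K)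
    hKc.continuousOn
  refine ⟨fun m s => s * G (m * s - 1), fun m s => K (m * s), max C 1, ?_, ?_, ?_, ?_, ?_, ?_⟩
  · intro m
    exact contDiff_id.mul (hG.comp ((contDiff_const.mul contDiff_id).sub contDiff_const))
  · intro m s
    have h1 : HasDerivAt (fun s : ℝ => (m : ℝ) * s - 1) m s := by
      simpa using ((hasDerivAt_id s).const_mul (m : ℝ)).sub_const 1
    have h2 : HasDerivAt G (deriv G (m * s - 1)) (m * s - 1) :=
      (hG.differentiable (by simp) _).hasDerivAt
    refine ((hasDerivAt_id s).mul (h2.comp s h1)).congr_deriv ?_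
    simp [K]; ring
  · intro m s
    rw [abs_mul, abs_of_nonneg (Real.smoothTransition.nonneg _)]
    exact mul_le_of_le_one_right (abs_nonneg s) (Real.smoothTransition.le_one _)
  · intro m s
    rcases lt_or_ge ((m : ℝ) * s) 0 with h | h
    · simp only [hK0 _ (by linarith : (m : ℝ) * s < 1)]; simp
    rcases le_or_gt ((m : ℝ) * s) 3 with h3 | h3
    · exact (hC _ ⟨h, h3⟩).trans (le_max_left _ _)
    · simp only [hK1 _ (by linarith : 2 < (m : ℝ) * s)]; simp
  · intro m s h
    by_contra! hlt
    exact h (by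
      have : G (m * s - 1) = 0 := Real.smoothTransition.zero_of_nonpos (by linarith)
      simp [this])
  · intro m s h
    refine ⟨?_, hK1 _ h⟩
    have : G (m * s - 1) = 1 := Real.smoothTransition.one_of_one_le (by linarith)
    simp [this]

lemma fderiv_comp_inner_mul {n : ℕ} {ν : EucSp n} {g : ℝ → ℝ} {d : ℝ} {h : EucSp n → ℝ}
    {x : EucSp n} (hg : HasDerivAt g d (inner ℝ ν x)) (hh : DifferentiableAt ℝ h x) :
    fderiv ℝ (fun x => g (inner ℝ ν x) * h x) x
      = g (inner ℝ ν x) • fderiv ℝ h x + h x • (d • innerSL ℝ ν) := by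
  have h1 : HasFDerivAt (fun x => g (inner ℝ ν x)) (d • innerSL ℝ ν) x :=
    HasDerivAt.comp_hasFDerivAt (h₂ := g) x hg (innerSL ℝ ν).hasFDerivAt
  exact (h1.mul hh.hasFDerivAt).fderiv

/-- A Hardy inequality for test functions of a half space extends to products of the defining
linear form with smooth functions supported away from the origin. -/
lemma hardy_halfSpace_inner_mul {n : ℕ} {c : ℝ} {ν : EucSp n}
    (hH : ∀ u, IsTestFunction {x | 0 < inner ℝ ν x} u →
      c * ∫ x, u x ^ 2 / ‖x‖ ^ 2 ≤ ∫ x, ‖∇ u x‖ ^ 2)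
    {h : EucSp n → ℝ} (hh : ContDiff ℝ ∞ h) (hc : HasCompactSupport h)
    (h0 : (0 : EucSp n) ∉ tsupport h) :
    c * ∫ x in {x | 0 < inner ℝ ν x}, (inner ℝ ν x * h x) ^ 2 / ‖x‖ ^ 2
      ≤ ∫ x in {x | 0 < inner ℝ ν x}, ‖∇ (fun x => inner ℝ ν x * h x) x‖ ^ 2 := by
  obtain ⟨g, g', C, hg, hgd, hgs, hgC, hg0, hg1⟩ := exists_smooth_cutoff_of_pos
  have hSmeas : MeasurableSet {x : EucSp n | 0 < inner ℝ ν x} :=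
    (isOpen_lt continuous_const (by fun_prop)).measurableSet
  have hinner : ContDiff ℝ ∞ (fun x : EucSp n => inner ℝ ν x) := contDiff_const.inner ℝ contDiff_id
  let u : ℕ → EucSp n → ℝ := fun m x => g m (inner ℝ ν x) * h x
  let U : EucSp n → ℝ := fun x => inner ℝ ν x * h x
  have hus : ∀ m, ContDiff ℝ ∞ (u m) := fun m => ((hg m).comp hinner).mul hh
  have huc : ∀ m, HasCompactSupport (u m) := fun m => hc.mul_left
  have huT : ∀ m, IsTestFunction {x | 0 < inner ℝ ν x} (u m) := by
    intro m
    refine ⟨hus m, huc m, ?_⟩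
    have hcl : IsClosed {x : EucSp n | 1 ≤ m * inner ℝ ν x} :=
      isClosed_le continuous_const (by fun_prop)
    refine (closure_minimal (fun x hx => ?_) hcl).trans fun x hx => ?_
    · exact hg0 m _ (left_ne_zero_of_mul hx)
    · have hx' : 1 ≤ (m : ℝ) * inner ℝ ν x := hx
      have : 0 < (m : ℝ) * inner ℝ ν x := by linarith
      exact pos_of_mul_pos_right this (by positivity)
  have hUc : HasCompactSupport U := hc.mul_left
  have hUs : ContDiff ℝ ∞ U := hinner.mul hh
  have hev : ∀ x : EucSp n, 0 < inner ℝ ν x → ∀ᶠ m : ℕ in atTop, 2 < (m : ℝ) * inner ℝ ν x :=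
    fun x hx => (tendsto_natCast_atTop_atTop.atTop_mul_const hx).eventually_gt_atTop 2
  have hhd : Differentiable ℝ h := hh.differentiable (by simp)
  have hfU : ∀ x, fderiv ℝ U x = inner ℝ ν x • fderiv ℝ h x + h x • ((1 : ℝ) • innerSL ℝ ν) :=
    fun x => fderiv_comp_inner_mul (g := fun s => s) (hasDerivAt_id _) (hhd x)
  have hfu : ∀ m x, fderiv ℝ (u m) x = g m (inner ℝ ν x) • fderiv ℝ h x
      + h x • (g' m (inner ℝ ν x) • innerSL ℝ ν) :=
    fun m x => fderiv_comp_inner_mul (hgd m _) (hhd x)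
  have T1 : Tendsto (fun m => ∫ x, u m x ^ 2 / ‖x‖ ^ 2) atTop
      (𝓝 (∫ x in {x | 0 < inner ℝ ν x}, U x ^ 2 / ‖x‖ ^ 2)) := by
    rw [← integral_indicator hSmeas]
    refine tendsto_integral_of_dominated_convergence (fun x => U x ^ 2 / ‖x‖ ^ 2)
      (fun m => ?_) ?_ (fun m => Eventually.of_forall fun x => ?_)
      (Eventually.of_forall fun x => ?_)
    · have := (hus m).continuous
      exact Measurable.aestronglyMeasurable (by fun_prop)
    · exact integrable_sq_div_norm_sq hUs.continuous hUc
        fun h => h0 (tsupport_mul_subset_right h)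
    · rw [Real.norm_of_nonneg (by positivity)]
      gcongr ?_ / _
      rw [sq_le_sq]
      simp only [u, U, abs_mul]
      exact mul_le_mul_of_nonneg_right (hgs m _) (abs_nonneg _)
    · by_cases hx : 0 < inner ℝ ν x
      · rw [indicator_of_mem (s := {x : EucSp n | 0 < inner ℝ ν x}) hx]
        refine tendsto_const_nhds.congr' ?_
        filter_upwards [hev x hx] with m hm
        simp only [u, U, (hg1 m _ hm).1]
      · rw [indicator_of_notMem (s := {x : EucSp n | 0 < inner ℝ ν x}) hx]
        refine tendsto_const_nhds.congr fun m => ?_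
        have : u m x = 0 := by
          by_contra hne
          exact hx ((huT m).2.2 (subset_tsupport _ hne))
        simp [this]
  have T2 : Tendsto (fun m => ∫ x, ‖∇ (u m) x‖ ^ 2) atTop
      (𝓝 (∫ x in {x | 0 < inner ℝ ν x}, ‖∇ U x‖ ^ 2)) := by
    rw [← integral_indicator hSmeas]
    have hdh : Continuous (fderiv ℝ h) := hh.continuous_fderiv (by simp)
    -- The bounds `|g m s| ≤ |s|` and `|g' m s| ≤ C` give a majorant independent of `m`, continuous
    -- with compact support.
    refine tendsto_integral_of_dominated_convergence
      (fun x => (|inner ℝ ν x| * ‖fderiv ℝ h x‖ + |h x| * (C * ‖ν‖)) ^ 2)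
      (fun m => ?_) ?_ (fun m => Eventually.of_forall fun x => ?_)
      (Eventually.of_forall fun x => ?_)
    · exact (integrable_norm_gradient_sq ((hus m).of_le (by exact_mod_cast le_top))
        (huc m)).aestronglyMeasurable
    · have := hh.continuous
      apply Continuous.integrable_of_hasCompactSupport (by fun_prop)
      have : HasCompactSupport
          (fun x => |inner ℝ ν x| * ‖fderiv ℝ h x‖ + |h x| * (C * ‖ν‖)) := by
        apply HasCompactSupport.add
        · exact ((hc.fderiv (𝕜 := ℝ)).comp_left (g := fun L : EucSp n →L[ℝ] ℝ => ‖L‖)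
            (by simp)).mul_left
        · exact (hc.comp_left (g := fun t : ℝ => |t|) (by simp)).mul_right
      exact this.comp_left (g := fun t : ℝ => t ^ 2) (by simp)
    · rw [Real.norm_of_nonneg (by positivity), norm_gradient, hfu]
      gcongr
      refine (norm_add_le _ _).trans ?_
      rw [norm_smul, norm_smul, norm_smul, innerSL_apply_norm, Real.norm_eq_abs, Real.norm_eq_abs,
        Real.norm_eq_abs]
      gcongr ?_ * _ + _ * (?_ * _)
      · exact hgs m _
      · exact hgC m _
    · by_cases hx : 0 < inner ℝ ν x
      · rw [indicator_of_mem (s := {x : EucSp n | 0 < inner ℝ ν x}) hx]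
        refine tendsto_const_nhds.congr' ?_
        filter_upwards [hev x hx] with m hm
        rw [norm_gradient, norm_gradient, hfu, hfU, (hg1 m _ hm).1, (hg1 m _ hm).2]
      · rw [indicator_of_notMem (s := {x : EucSp n | 0 < inner ℝ ν x}) hx]
        refine tendsto_const_nhds.congr fun m => ?_
        have : fderiv ℝ (u m) x = 0 := image_eq_zero_of_notMem_tsupport fun hh =>
          hx ((huT m).2.2 (tsupport_fderiv_subset ℝ hh))
        rw [norm_gradient, this]; simp
  exact le_of_tendsto_of_tendsto' (T1.const_mul c) T2 fun m => hH _ (huT m)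

/-! ### Symmetrisation and reduction to radial profiles -/

/-- The map `x ↦ -x` swaps the two open half spaces, and the hyperplane between them is null. -/
lemma integral_eq_two_mul_setIntegral_of_even {n : ℕ} {ν : EucSp n} (hν : ν ≠ 0)
    {f : EucSp n → ℝ} (hf : Integrable f) (heven : ∀ x, f (-x) = f x) :
    ∫ x, f x = 2 * ∫ x in {x | 0 < inner ℝ ν x}, f x := by
  have hSmeas : MeasurableSet {x : EucSp n | 0 < inner ℝ ν x} :=
    (isOpen_lt continuous_const (by fun_prop)).measurableSet
  rw [← integral_indicator hSmeas]
  set F := indicator {x : EucSp n | 0 < inner ℝ ν x} f with hF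
  have hFi : Integrable F := hf.indicator hSmeas
  have hne : ∀ᵐ x : EucSp n, inner ℝ ν x ≠ 0 := by
    have hz : volume ((LinearMap.ker (innerSL ℝ ν).toLinearMap : Submodule ℝ (EucSp n)) :
        Set (EucSp n)) = 0 := by
      apply Measure.addHaar_submodule
      intro htop
      have : ν ∈ LinearMap.ker (innerSL ℝ ν).toLinearMap := htop ▸ Submodule.mem_top
      simp at this
      exact hν this
    refine measure_mono_null (fun x hx => ?_) hz
    simpa using hx
  have h1 : ∫ x, f x = ∫ x, (F x + F (-x)) := by
    refine integral_congr_ae ?_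
    filter_upwards [hne] with x hx
    rcases lt_or_gt_of_ne hx with h | h
    · have a1 : x ∉ {x : EucSp n | 0 < inner ℝ ν x} := not_lt.2 h.le
      have a2 : -x ∈ {x : EucSp n | 0 < inner ℝ ν x} := by
        simp only [mem_ofPred_eq, inner_neg_right]; linarith
      rw [hF, indicator_of_notMem a1, indicator_of_mem a2, heven, zero_add]
    · have a1 : x ∈ {x : EucSp n | 0 < inner ℝ ν x} := h
      have a2 : -x ∉ {x : EucSp n | 0 < inner ℝ ν x} := by
        simp only [mem_ofPred_eq, inner_neg_right]; linarith
      rw [hF, indicator_of_mem a1, indicator_of_notMem a2, add_zero]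
  rw [h1, integral_add hFi hFi.comp_neg, integral_neg_eq_self]
  ring

/-- A reflection carrying `ν` to a coordinate vector preserves `|x|` and the volume, so every `x i ^
2` has the same integral as `⟨ν, x⟩²`; summing over `i` gives `|x|²`. -/
lemma integral_norm_sq_mul_radial {n : ℕ} {ν : EucSp n} (hν : ‖ν‖ = 1) {f : ℝ → ℝ}
    (hf : Integrable (fun x : EucSp n => inner ℝ ν x ^ 2 * f ‖x‖)) :
    ∫ x : EucSp n, ‖x‖ ^ 2 * f ‖x‖ = n * ∫ x : EucSp n, inner ℝ ν x ^ 2 * f ‖x‖ := by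
  have key : ∀ i : Fin n, Integrable (fun x : EucSp n => x i ^ 2 * f ‖x‖) ∧
      ∫ x : EucSp n, x i ^ 2 * f ‖x‖ = ∫ x : EucSp n, inner ℝ ν x ^ 2 * f ‖x‖ := by
    intro i
    let e : EucSp n := EuclideanSpace.single i 1
    have he : ‖ν‖ = ‖e‖ := by simp [e, hν]
    let T : EucSp n ≃ₗᵢ[ℝ] EucSp n := (ℝ ∙ (ν - e))ᗮ.reflection
    have hT : T ν = e := Submodule.reflection_sub he
    have hcomp : (fun x : EucSp n => inner ℝ ν x ^ 2 * f ‖x‖)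
        = (fun x : EucSp n => x i ^ 2 * f ‖x‖) ∘ T := by
      funext x
      have h1 : (T x) i = inner ℝ ν x := by
        rw [← T.inner_map_map, hT]
        simp [e, EuclideanSpace.inner_single_left]
      simp [h1]
    have hmp := T.measurePreserving
    have hemb : MeasurableEmbedding T := T.toHomeomorph.measurableEmbedding
    constructor
    · rw [hcomp, hmp.integrable_comp_emb hemb] at hf
      exact hf
    · rw [hcomp]
      exact (hmp.integral_comp hemb _).symm
  have hsum : ∀ x : EucSp n, ‖x‖ ^ 2 * f ‖x‖ = ∑ i, x i ^ 2 * f ‖x‖ := by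
    intro x
    rw [EuclideanSpace.real_norm_sq_eq, Finset.sum_mul]
  simp_rw [hsum]
  rw [integral_finsetSum _ fun i _ => (key i).1]
  simp [key]

lemma hasFDerivAt_comp_norm {n : ℕ} {k : ℝ → ℝ} {d : ℝ} {x : EucSp n} (hx : x ≠ 0)
    (hk : HasDerivAt k d ‖x‖) :
    HasFDerivAt (fun x : EucSp n => k ‖x‖) ((d / ‖x‖) • innerSL ℝ x) x := by
  have hr : 0 < ‖x‖ := norm_pos_iff.2 hx
  have h1 : HasFDerivAt (fun x : EucSp n => ‖x‖) (‖x‖⁻¹ • innerSL ℝ x) x := by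
    have h2 := (hasFDerivAt_norm_sq_euclidean x).sqrt (by positivity)
    simp only [Real.sqrt_sq (norm_nonneg _)] at h2
    refine h2.congr_fderiv ?_
    rw [smul_smul]
    congr 1
    field_simp
  refine (HasDerivAt.comp_hasFDerivAt (h₂ := k) x hk h1).congr_fderiv ?_
  rw [smul_smul]
  rfl

/-- Testing the half space Hardy inequality with `⟨ν, x⟩ k(|x|)` reduces it to an inequality for
the Euler derivative of the radial function `k(|x|)`. -/
lemma integral_radial_le_of_hardy_halfSpace {n : ℕ} {c : ℝ} {ν : EucSp n}
    (hν : ‖ν‖ = 1)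
    (hH : ∀ u, IsTestFunction {x | 0 < inner ℝ ν x} u →
      c * ∫ x, u x ^ 2 / ‖x‖ ^ 2 ≤ ∫ x, ‖∇ u x‖ ^ 2)
    {k : ℝ → ℝ} {a b : ℝ} (ha : 0 < a) (hk : ContDiffOn ℝ ∞ k (Ioi 0))
    (hk0 : ∀ r, 0 ≤ r → r ∉ Icc a b → k r = 0) :
    c * ∫ x : EucSp n, k ‖x‖ ^ 2 ≤ ∫ x : EucSp n, (‖x‖ * deriv k ‖x‖) ^ 2 := by
  let h : EucSp n → ℝ := fun x => k ‖x‖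
  have hts : tsupport h ⊆ {x : EucSp n | ‖x‖ ∈ Icc a b} := by
    refine closure_minimal (fun x hx => ?_) (isClosed_Icc.preimage continuous_norm)
    by_contra hne
    exact hx (hk0 _ (norm_nonneg x) hne)
  have h0 : (0 : EucSp n) ∉ tsupport h := fun hh => by
    have := (hts hh).1
    rw [norm_zero] at this
    linarith
  have hkd : ∀ r, 0 < r → HasDerivAt k (deriv k r) r := fun r hr =>
    ((hk.contDiffAt (Ioi_mem_nhds hr)).differentiableAt (by simp)).hasDerivAt
  have hh : ContDiff ℝ ∞ h := by
    refine contDiff_iff_contDiffAt.2 fun x => ?_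
    by_cases hx : x = 0
    · subst hx
      refine (contDiffAt_const (c := (0 : ℝ))).congr_of_eventuallyEq ?_
      exact notMem_tsupport_iff_eventuallyEq.1 h0
    · exact (hk.contDiffAt (Ioi_mem_nhds (norm_pos_iff.2 hx))).comp x (contDiffAt_norm ℝ hx)
  have hh1 : ContDiff ℝ 1 h := hh.of_le (by exact_mod_cast le_top)
  have hc : HasCompactSupport h := by
    refine HasCompactSupport.of_support_subset_isCompact (isCompact_closedBall 0 b) fun x hx => ?_
    simpa using (hts (subset_tsupport _ hx)).2
  have hfd : ∀ x, fderiv ℝ h x = (deriv k ‖x‖ / ‖x‖) • innerSL ℝ x := by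
    intro x
    by_cases hx : x = 0
    · subst hx
      rw [image_eq_zero_of_notMem_tsupport fun hh => h0 (tsupport_fderiv_subset ℝ hh)]
      simp
    · exact (hasFDerivAt_comp_norm hx (hkd _ (norm_pos_iff.2 hx))).fderiv
  let U : EucSp n → ℝ := fun x => inner ℝ ν x * h x
  have hinner : ContDiff ℝ ∞ (fun x : EucSp n => inner ℝ ν x) := contDiff_const.inner ℝ contDiff_id
  have hU : ContDiff ℝ ∞ U := hinner.mul hh
  have hUc : HasCompactSupport U := hc.mul_left
  have hU0 : (0 : EucSp n) ∉ tsupport U := fun hh => h0 (tsupport_mul_subset_right hh)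
  -- Separates `|∇U|²` into a radial part and `⟨ν, x⟩²` times a radial function, ready for
  -- averaging.
  let f : ℝ → ℝ := fun r => 2 * k r * (deriv k r / r) + (deriv k r / r) ^ 2 * r ^ 2
  have hgU : ∀ x, ‖∇ U x‖ ^ 2 = k ‖x‖ ^ 2 + inner ℝ ν x ^ 2 * f ‖x‖ := by
    intro x
    have h1 : fderiv ℝ U x = innerSL ℝ ((inner ℝ ν x * (deriv k ‖x‖ / ‖x‖)) • x + h x • ν) := by
      have := fderiv_comp_inner_mul (ν := ν) (g := fun s => s) (hasDerivAt_id (inner ℝ ν x))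
        (hh.differentiable (by simp) x)
      rw [hfd] at this
      refine this.trans ?_
      ext z
      simp
      ring
    rw [norm_gradient, h1, innerSL_apply_norm, norm_add_sq_real, norm_smul, norm_smul, hν,
      inner_smul_left, inner_smul_right, mul_pow, mul_pow, Real.norm_eq_abs, Real.norm_eq_abs,
      sq_abs, sq_abs, real_inner_comm]
    simp only [conj_trivial, h, f]
    ring
  have hI1 : Integrable (fun x => ‖∇ U x‖ ^ 2) :=
    integrable_norm_gradient_sq (hU.of_le (by exact_mod_cast le_top)) hUc
  have hI2 : Integrable (fun x => U x ^ 2 / ‖x‖ ^ 2) :=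
    integrable_sq_div_norm_sq hU.continuous hUc hU0
  have hcsq : HasCompactSupport (fun x => h x ^ 2) :=
    hc.comp_left (g := fun t : ℝ => t ^ 2) (by simp)
  have hIh : Integrable (fun x => h x ^ 2) :=
    Continuous.integrable_of_hasCompactSupport (hh.continuous.pow 2) hcsq
  have hI3 : Integrable (fun x : EucSp n => k ‖x‖ ^ 2) := hIh
  have hI4 : Integrable (fun x : EucSp n => inner ℝ ν x ^ 2 * f ‖x‖) := by
    refine (hI1.sub hI3).congr (Eventually.of_forall fun x => ?_)
    simp [hgU]
  have hUx : ∀ x, U x ^ 2 / ‖x‖ ^ 2 = inner ℝ ν x ^ 2 * (k ‖x‖ ^ 2 / ‖x‖ ^ 2) := by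
    intro x; simp only [U, h]; ring
  have hν0 : ν ≠ 0 := fun h => by simp [h] at hν
  have hfull : c * ∫ x, U x ^ 2 / ‖x‖ ^ 2 ≤ ∫ x, ‖∇ U x‖ ^ 2 := by
    rw [integral_eq_two_mul_setIntegral_of_even hν0 hI1 fun x => by simp [hgU],
      integral_eq_two_mul_setIntegral_of_even hν0 hI2 fun x => by rw [hUx, hUx]; simp]
    have := hardy_halfSpace_inner_mul hH hh hc h0
    linarith
  have e1 : ∫ x : EucSp n, k ‖x‖ ^ 2 = n * ∫ x, U x ^ 2 / ‖x‖ ^ 2 := by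
    simp_rw [hUx] at hI2 ⊢
    rw [← integral_norm_sq_mul_radial hν (f := fun r => k r ^ 2 / r ^ 2) hI2]
    congr 1 with x
    by_cases hx : ‖x‖ = 0
    · rw [hx, hk0 0 le_rfl fun h => by linarith [h.1]]; simp
    · field_simp
  have hI5 : Integrable (fun x : EucSp n => 2 * (k ‖x‖ * (‖x‖ * deriv k ‖x‖))) := by
    have hd : Continuous (fderiv ℝ h) := hh.continuous_fderiv (by simp)
    have hcont : Continuous (fun x => 2 * (h x * fderiv ℝ h x x)) := by
      have := hh.continuous
      fun_prop
    have : HasCompactSupport (fun x => 2 * (h x * fderiv ℝ h x x)) := hc.mul_right.mul_left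
    refine (hcont.integrable_of_hasCompactSupport this).congr (Eventually.of_forall fun x => ?_)
    simp only [hfd, h, smul_apply, innerSL_apply_apply, smul_eq_mul, real_inner_self_eq_norm_sq]
    by_cases hx : ‖x‖ = 0
    · simp [hx]
    · field_simp
  have hI6 : Integrable (fun x : EucSp n => (‖x‖ * deriv k ‖x‖) ^ 2) := by
    have hd : Continuous (fderiv ℝ h) := hh.continuous_fderiv (by simp)
    have hcont : Continuous (fun x => (fderiv ℝ h x x) ^ 2) := by fun_prop
    have : HasCompactSupport (fun x => (fderiv ℝ h x x) ^ 2) := by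
      refine (hc.fderiv (𝕜 := ℝ)).mono fun x hx => ?_
      simp only [Function.mem_support] at hx ⊢
      exact fun h0 => hx (by simp [h0])
    refine (hcont.integrable_of_hasCompactSupport this).congr (Eventually.of_forall fun x => ?_)
    simp only [hfd, smul_apply, innerSL_apply_apply, smul_eq_mul, real_inner_self_eq_norm_sq]
    by_cases hx : ‖x‖ = 0
    · simp [hx]
    · field_simp
  -- Averaging leaves the integrand `n k² + 2 k r k' + (r k')²`, whose first two terms form the
  -- divergence of `k² x` and integrate to zero.
  have e2 : n * ∫ x, ‖∇ U x‖ ^ 2 = ∫ x : EucSp n, (‖x‖ * deriv k ‖x‖) ^ 2 := by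
    simp_rw [hgU]
    rw [integral_add hI3 hI4, mul_add, ← integral_norm_sq_mul_radial hν hI4]
    have h1 : ∀ x : EucSp n, ‖x‖ ^ 2 * f ‖x‖
        = 2 * (k ‖x‖ * (‖x‖ * deriv k ‖x‖)) + (‖x‖ * deriv k ‖x‖) ^ 2 := by
      intro x
      by_cases hx : ‖x‖ = 0
      · simp [hx]
      · simp only [f]; field_simp
    simp_rw [h1]
    rw [integral_add hI5 hI6]
    have h2 := integral_fderiv_self_add_eq_zero (hh1.pow 2) hcsq
    have h3 : ∀ x, fderiv ℝ (fun x => h x ^ 2) x x = 2 * (k ‖x‖ * (‖x‖ * deriv k ‖x‖)) := by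
      intro x
      have := (((hh.differentiable (by simp) x).hasFDerivAt).pow 2).fderiv
      rw [this, hfd]
      simp only [h, smul_apply, innerSL_apply_apply, smul_eq_mul, real_inner_self_eq_norm_sq]
      by_cases hx : ‖x‖ = 0
      · simp [hx]
      · simp; field_simp
    have h4 : ∫ x : EucSp n, (2 * (k ‖x‖ * (‖x‖ * deriv k ‖x‖)) + n * k ‖x‖ ^ 2) = 0 := by
      rw [← h2]
      congr 1 with x
      rw [← h3]
    rw [integral_add hI5 (hI3.const_mul _), integral_const_mul (n : ℝ)] at h4
    linarith
  rw [e1, ← e2]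
  have hn0 : (0 : ℝ) ≤ n := by positivity
  rw [mul_left_comm]
  exact mul_le_mul_of_nonneg_left hfull hn0

/-! ### The one-dimensional limit -/

/-- The one-dimensional inequality obtained from radial functions `r^{-n/2} θ(r^q)`. -/
lemma integral_bump_le_of_hardy_halfSpace {n : ℕ} (hn : n ≠ 0) {c : ℝ} {ν : EucSp n}
    (hν : ‖ν‖ = 1)
    (hH : ∀ u, IsTestFunction {x | 0 < inner ℝ ν x} u →
      c * ∫ x, u x ^ 2 / ‖x‖ ^ 2 ≤ ∫ x, ‖∇ u x‖ ^ 2)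
    {θ : ℝ → ℝ} (hθ : ContDiff ℝ ∞ θ) (hθ0 : ∀ s, s ∉ Ioo 1 3 → θ s = 0) {q : ℝ} (hq : 0 < q) :
    c * ∫ s in Ioi (0 : ℝ), s⁻¹ * θ s ^ 2
      ≤ ∫ s in Ioi (0 : ℝ), s⁻¹ * (q * (s * deriv θ s) - n / 2 * θ s) ^ 2 := by
  have : NeZero n := ⟨hn⟩
  let k : ℝ → ℝ := fun r => r ^ (-(n : ℝ) / 2) * θ (r ^ q)
  have hk : ContDiffOn ℝ ∞ k (Ioi 0) := by
    intro r hr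
    have hr' : r ≠ 0 := (mem_Ioi.1 hr).ne'
    exact ((contDiffAt_id.rpow_const_of_ne hr').mul
      (hθ.contDiffAt.comp r (contDiffAt_id.rpow_const_of_ne hr'))).contDiffWithinAt
  have hk0 : ∀ r, 0 ≤ r → r ∉ Icc 1 ((3 : ℝ) ^ q⁻¹) → k r = 0 := by
    intro r hr hnot
    have : θ (r ^ q) = 0 := by
      refine hθ0 _ fun hmem => hnot ⟨?_, ?_⟩
      · by_contra! hlt
        exact absurd hmem.1 (not_lt.2 (Real.rpow_le_one hr hlt.le hq.le))
      · have := Real.rpow_le_rpow (Real.rpow_nonneg hr q) hmem.2.le (inv_pos.2 hq).le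
        rwa [← Real.rpow_mul hr, mul_inv_cancel₀ hq.ne', Real.rpow_one] at this
    simp only [k, this, mul_zero]
  have hdk : ∀ r, 0 < r → r * deriv k r
      = r ^ (-(n : ℝ) / 2) * (q * (r ^ q * deriv θ (r ^ q)) - n / 2 * θ (r ^ q)) := by
    intro r hr
    have h1 := Real.hasDerivAt_rpow_const (x := r) (p := -(n : ℝ) / 2) (Or.inl hr.ne')
    have h2 := Real.hasDerivAt_rpow_const (x := r) (p := q) (Or.inl hr.ne')
    have h3 : HasDerivAt θ (deriv θ (r ^ q)) (r ^ q) :=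
      (hθ.differentiable (by simp) _).hasDerivAt
    have h4 := (h1.mul (h3.comp r h2)).deriv
    have h5 : deriv k r = _ := h4
    rw [h5, Real.rpow_sub_one hr.ne', Real.rpow_sub_one hr.ne']
    simp only [Function.comp]
    field_simp
    ring
  have h := integral_radial_le_of_hardy_halfSpace hν hH one_pos hk hk0
  rw [integral_fun_norm_addHaar volume (fun r => k r ^ 2),
    integral_fun_norm_addHaar volume (fun r => (r * deriv k r) ^ 2)] at h
  simp only [finrank_euclideanSpace, Fintype.card_fin, nsmul_eq_mul, smul_eq_mul] at h
  -- The exponent `-n/2` turns the polar weight `r^{n-1}` into `dr / r`, which `s = r^q` maps to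
  -- `q⁻¹ ds / s`. The factor `q⁻¹` then appears on both sides and drops out.
  have hpw : ∀ r : ℝ, 0 < r → r ^ (n - 1) * (r ^ (-(n : ℝ) / 2)) ^ 2 = r⁻¹ := by
    intro r hr
    rw [← Real.rpow_natCast (r ^ (-(n : ℝ) / 2)), ← Real.rpow_mul hr.le, ← Real.rpow_natCast,
      ← Real.rpow_add hr, ← Real.rpow_neg_one, Nat.cast_sub (Nat.one_le_iff_ne_zero.2 hn)]
    congr 1
    push_cast
    ring
  have hsub : ∀ g : ℝ → ℝ, ∫ r in Ioi (0 : ℝ), r⁻¹ * g (r ^ q)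
      = q⁻¹ * ∫ s in Ioi (0 : ℝ), s⁻¹ * g s := by
    intro g
    rw [← integral_comp_rpow_Ioi (fun s => s⁻¹ * g s) hq.ne', ← integral_const_mul]
    refine setIntegral_congr_fun measurableSet_Ioi fun r hr => ?_
    have hr' : 0 < r := hr
    have : 0 < r ^ q := Real.rpow_pos_of_pos hr' q
    simp only [smul_eq_mul]
    rw [abs_of_pos hq, Real.rpow_sub_one hr'.ne']
    field_simp
  have i1 : ∫ r in Ioi (0 : ℝ), r ^ (n - 1) * k r ^ 2
      = q⁻¹ * ∫ s in Ioi (0 : ℝ), s⁻¹ * θ s ^ 2 := by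
    rw [← hsub fun s => θ s ^ 2]
    refine setIntegral_congr_fun measurableSet_Ioi fun r hr => ?_
    simp only [k]
    rw [mul_pow, ← mul_assoc, hpw r hr]
  have i2 : ∫ r in Ioi (0 : ℝ), r ^ (n - 1) * (r * deriv k r) ^ 2
      = q⁻¹ * ∫ s in Ioi (0 : ℝ), s⁻¹ * (q * (s * deriv θ s) - n / 2 * θ s) ^ 2 := by
    rw [← hsub fun s => (q * (s * deriv θ s) - n / 2 * θ s) ^ 2]
    refine setIntegral_congr_fun measurableSet_Ioi fun r hr => ?_
    rw [hdk r hr, mul_pow, ← mul_assoc, hpw r hr]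
  rw [i1, i2] at h
  have hV : 0 < (volume : Measure (EucSp n)).real (Metric.ball 0 1) :=
    ENNReal.toReal_pos (Metric.measure_ball_pos volume 0 one_pos).ne' measure_ball_lt_top.ne
  have hpos : 0 < (n : ℝ) * ((volume : Measure (EucSp n)).real (Metric.ball 0 1) * q⁻¹) := by
    have : (0 : ℝ) < n := by exact_mod_cast Nat.pos_of_ne_zero hn
    positivity
  refine le_of_mul_le_mul_left ?_ hpos
  linarith

/-- For a fixed bump `θ` the bound is quadratic in `q`, with value `(n²/4) J0` at `q = 0`; letting
`q → 0+` and dividing by `J0 > 0` gives the claim. -/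
lemma le_of_hardy_halfSpace {n : ℕ} (hn : n ≠ 0) {c : ℝ} {ν : EucSp n} (hν : ‖ν‖ = 1)
    (hH : ∀ u, IsTestFunction {x | 0 < inner ℝ ν x} u →
      c * ∫ x, u x ^ 2 / ‖x‖ ^ 2 ≤ ∫ x, ‖∇ u x‖ ^ 2) :
    c ≤ (n : ℝ) ^ 2 / 4 := by
  -- The support `[1, 3]` stays away from `0`, where the weight `s⁻¹` is singular.
  let θ : ContDiffBump (2 : ℝ) := ⟨1 / 2, 1, by norm_num, by norm_num⟩
  have hθ : ContDiff ℝ ∞ θ := θ.contDiff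
  have hθ0 : ∀ s, s ∉ Ioo 1 3 → θ s = 0 := by
    intro s hs
    apply θ.zero_of_le_dist
    rw [Real.dist_eq]
    by_contra! hlt
    have := abs_lt.1 hlt
    simp only [θ] at this
    exact hs ⟨by linarith, by linarith⟩
  have hθts : tsupport θ ⊆ Icc 1 3 := by
    rw [θ.tsupport_eq, Real.closedBall_eq_Icc]
    norm_num [θ]
  have hInt : ∀ F : ℝ → ℝ, Continuous F → (∀ s, s ∉ Icc (1 : ℝ) 3 → F s = 0) →
      IntegrableOn (fun s => s⁻¹ * F s) (Ioi 0) := by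
    intro F hF hF0
    have h1 : IntegrableOn (fun s => s⁻¹ * F s) (Icc 1 3) := by
      refine ContinuousOn.integrableOn_Icc (ContinuousOn.mul ?_ hF.continuousOn)
      exact continuousOn_inv₀.mono fun s hs => by
        have := hs.1
        simp only [mem_compl_iff, mem_singleton_iff]
        linarith
    refine Integrable.integrableOn ?_
    refine (integrableOn_iff_integrable_of_support_subset fun s hs => ?_).1 h1
    by_contra hne
    exact hs (by simp [hF0 s hne])
  have hd : Continuous (deriv θ) := hθ.continuous_deriv (by simp)
  have hd0 : ∀ s, s ∉ Icc (1 : ℝ) 3 → deriv θ s = 0 := fun s hs =>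
    image_eq_zero_of_notMem_tsupport fun hh =>
      hs (hθts (closure_minimal support_deriv_subset (isClosed_tsupport _) hh))
  have hz : ∀ s, s ∉ Icc (1 : ℝ) 3 → θ s = 0 := fun s hs =>
    hθ0 s fun h => hs (Ioo_subset_Icc_self h)
  have I0 := hInt (fun s => θ s ^ 2) (by have := hθ.continuous; fun_prop)
    fun s hs => by simp [hz s hs]
  have I1 := hInt (fun s => s * deriv θ s * θ s) (by have := hθ.continuous; fun_prop)
    fun s hs => by simp [hz s hs]
  have I2 := hInt (fun s => (s * deriv θ s) ^ 2) (by fun_prop)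
    fun s hs => by simp [hd0 s hs]
  set J0 := ∫ s in Ioi (0 : ℝ), s⁻¹ * θ s ^ 2 with hJ0
  set J1 := ∫ s in Ioi (0 : ℝ), s⁻¹ * (s * deriv θ s * θ s)
  set J2 := ∫ s in Ioi (0 : ℝ), s⁻¹ * (s * deriv θ s) ^ 2
  have hq : ∀ q : ℝ, 0 < q → c * J0 ≤ q ^ 2 * J2 - n * q * J1 + (n : ℝ) ^ 2 / 4 * J0 := by
    intro q hq
    refine (integral_bump_le_of_hardy_halfSpace hn hν hH hθ hθ0 hq).trans (le_of_eq ?_)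
    have hI : IntegrableOn (fun s => q ^ 2 * (s⁻¹ * (s * deriv θ s) ^ 2)
        - n * q * (s⁻¹ * (s * deriv θ s * θ s))) (Ioi 0) := (I2.const_mul _).sub (I1.const_mul _)
    rw [← integral_const_mul, ← integral_const_mul, ← integral_const_mul,
      ← integral_sub (I2.const_mul _) (I1.const_mul _),
      ← integral_add hI (I0.const_mul _)]
    congr 1 with s
    ring
  have hlim : c * J0 ≤ (n : ℝ) ^ 2 / 4 * J0 := by
    have ht : Tendsto (fun q : ℝ => q ^ 2 * J2 - n * q * J1 + (n : ℝ) ^ 2 / 4 * J0) (𝓝[>] 0)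
        (𝓝 ((n : ℝ) ^ 2 / 4 * J0)) := by
      have : Continuous (fun q : ℝ => q ^ 2 * J2 - n * q * J1 + (n : ℝ) ^ 2 / 4 * J0) := by
        fun_prop
      simpa using (this.tendsto 0).mono_left nhdsWithin_le_nhds
    exact ge_of_tendsto ht (eventually_mem_nhdsWithin.mono fun q hq' => hq q hq')
  have hpos : 0 < J0 := by
    rw [hJ0, setIntegral_pos_iff_support_of_nonneg_ae ?_ I0]
    · refine lt_of_lt_of_le ?_ (measure_mono (s := Ioo (3 / 2 : ℝ) (5 / 2)) fun s hs => ?_)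
      · simp; norm_num
      · have hs0 : 0 < s := by linarith [hs.1]
        have h1 : θ s = 1 := θ.one_of_mem_closedBall (by
          rw [Real.closedBall_eq_Icc]
          constructor <;> simp only [θ] <;> linarith [hs.1, hs.2])
        exact ⟨by simp [h1, hs0.ne'], hs0⟩
    · refine (ae_restrict_mem measurableSet_Ioi).mono fun s hs => ?_
      have : 0 < s := hs
      simp only [Pi.zero_apply]
      positivity
  exact le_of_mul_le_mul_right hlim hpos

lemma HardyInequality.le_of_hasInteriorBall {n : ℕ} (hn : n ≠ 0) {Ω : Set (EucSp n)} {c : ℝ}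
    (hH : HardyInequality Ω c) (hΩ : HasInteriorBall Ω) : c ≤ (n : ℝ) ^ 2 / 4 := by
  obtain ⟨y, r, hr, hy, hball⟩ := hΩ
  refine le_of_hardy_halfSpace hn (ν := r⁻¹ • y) ?_ fun u hu => ?_
  · rw [norm_smul, hy, norm_inv, Real.norm_of_nonneg hr.le, inv_mul_cancel₀ hr.ne']
  · refine hH.halfSpace hy hball ⟨hu.1, hu.2.1, hu.2.2.trans fun x hx => ?_⟩
    have hx' : 0 < inner ℝ (r⁻¹ • y) x := hx
    rw [inner_smul_left] at hx'
    exact pos_of_mul_pos_right hx' (by simpa using hr.le)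

theorem theorem1p1 (n : ℕ) (hn : 2 ≤ n) :
    ∃ τ : ℝ, 0 < τ ∧
      ∀ (Ω : Set (EucSp n)) (ρ : ℝ), IsBoundedDomain Ω → (0 : EucSp n) ∈ frontier Ω →
        HasExteriorBall hn Ω ρ → maxNorm Ω / τ ≤ ρ →
          HardyInequality Ω ((n : ℝ) ^ 2 / 4) ∧
          (HasInteriorBall Ω →
            IsGreatest {c : ℝ | HardyInequality Ω c} ((n : ℝ) ^ 2 / 4)) := by
  have hn0 : n ≠ 0 := by omega
  -- With `ε = 1/(2ρ)`, the condition `ρ ≥ 8n² D` is what gives `δ |x| = 8n² ε |x| ≤ 1/2` on `Ω`.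
  refine ⟨1 / (8 * (n : ℝ) ^ 2), by positivity, fun Ω ρ hΩ _ hext hρ => ?_⟩
  have hH := hardyInequality_of_exteriorBall hn hΩ.1 hΩ.2.2 hext hρ
  exact ⟨hH, fun hInt => ⟨hH, fun c hc => HardyInequality.le_of_hasInteriorBall hn0 hc hInt⟩⟩
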